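/- All Hilbert spaces are finite dimensional, nonzero, and come with a fixed orthonormal basis, which is used for transposes and Choi matrices. Let $\mathcal A=\bigoplus_k B(\mathcal H_{A_k})$, $\mathcal B=\bigoplus_m B(\mathcal H_{B_m})$, $\mathcal C=\bigoplus_n B(\mathcal H_{C_n})$ be nonzero finite-dimensional $C^*$-algebras (finite direct sums), regarded as algebras of block-diagonal operators on $\mathcal H_A=\bigoplus_k\mathcal H_{A_k}$, $\mathcal H_B=\bigoplus_m\mathcal H_{B_m}$, $\mathcal H_C=\bigoplus_n\mathcal H_{C_n}$. Let $\{q_m\}$ and $\{r_n\}$ be the minimal central projections of $\mathcal B$ and $\mathcal C$ belonging to these blocks, and let $\mathrm{Tr}_{\mathcal A}$ be the partial trace over $\mathcal H_A$. For operators $X$ on $\mathcal H_1\otimes\mathcal H_D$ and $Z$ on $\mathcal H_D\otimes\mathcal H_2$ the link product is the operator $$X*Z=\mathrm{Tr}_D\big[(I_{\mathcal H_1}\otimes Z^{T_D})(X\otimes I_{\mathcal H_2})\big]$$ on $\mathcal H_1\otimes\mathcal H_2$, where $T_D$ is the partial transpose on $\mathcal H_D$. The Choi matrix of a linear map $T:B(\mathcal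 K)\to\mathcal A$ is $\sum_{i,j}T(|i\rangle\langle j|)\otimes|i\rangle\langle j|\in\mathcal A\otimes B(\mathcal K)$, where $(|i\rangle)_i$ is the fixed basis of $\mathcal K$. A channel is a completely positive trace-preserving linear map, and $\mathfrak C(B(\mathcal K),\mathcal A)$ denotes the set of Choi matrices of channels $B(\mathcal K)\to\mathcal A$. Let $X\in\mathcal A\otimes\mathcal B\otimes\mathcal C$ be positive. Then the following are equivalent. (i) There is a positive element $Y\in\mathcal C$ such that $\mathrm{Tr}_{\mathcal A}X=I_{\mathcal B}\otimes Y$. (ii) There are an auxiliary Hilbert space $\mathcal H_D$ (the same for all $m,n$), positive operators $X_0(n)\in B(\mathcal H_D\otimes\mathcal H_{C_n})$, and elements $X_1(m,n)\in\mathfrak C(B(\mathcal H_{B_m}\otimes\mathcal H_D),\mathcal A)$ such that for all $m,n$ $$(I_{\mathcal A}\otimes q_m\otimes r_n)X=X_1(m,n)*X_0(n).$$ Here the link product is taken over $\mathcal H_D$, and operators on $\mathcal H_A\otimes\mathcal H_{B_m}\otimes\mathcal H_{C_n}$ are regarded as operators on $\mathcal H_A\otimes\mathcal H_B\otimes\mathcal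 H_C$ supported on that summand. Moreover, whenever $Y$ is as in (i) and $\mathcal H_D$, $X_0(n)$, $X_1(m,n)$ are as in (ii), we have $\mathrm{Tr}_D X_0(n)=r_nY$ for every $n$, where operators on $\mathcal H_{C_n}$ are regarded as operators on $\mathcal H_C$ supported on $\mathcal H_{C_n}$. -/

import Mathlib

open scoped Kronecker ComplexOrder

namespace QLink

section Definitions

/-- The finite dimensional C*-algebra `⊕ₖ B(ℂ^{h k})`, realised as the algebra of block-diagonal
operators on the Hilbert space `⊕ₖ ℂ^{h k}`, whose canonical basis is indexed by `Σ k, h k`. -/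
def directSumAlg {κ : Type*} (h : κ → Type*) [Fintype κ] [∀ k, Fintype (h k)]
    [DecidableEq κ] [∀ k, DecidableEq (h k)] :
    StarSubalgebra ℂ (Matrix (Σ k, h k) (Σ k, h k) ℂ) where
  carrier := {M | ∀ i j : (Σ k, h k), i.1 ≠ j.1 → M i j = 0}
  mul_mem' := by
    intro M N hM hN i j hij
    rw [Matrix.mul_apply]
    refine Finset.sum_eq_zero fun l _ => ?_
    by_cases hil : i.1 = l.1
    · rw [hN l j (fun h => hij (hil.trans h)), mul_zero]
    · rw [hM i l hil, zero_mul]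
  add_mem' := by
    intro M N hM hN i j hij
    rw [Matrix.add_apply, hM i j hij, hN i j hij, add_zero]
  algebraMap_mem' := by
    intro r i j hij
    rw [Matrix.algebraMap_matrix_apply, if_neg (fun h => hij (congrArg Sigma.fst h))]
  star_mem' := by
    intro M hM i j hij
    rw [Matrix.star_apply, hM j i (Ne.symm hij), star_zero]

/-- The minimal central projection of `⊕ₖ B(ℂ^{h k})` that belongs to the block `k`. -/
def centralProj {κ : Type*} (h : κ → Type*) [DecidableEq κ] [∀ k, DecidableEq (h k)] (k : κ) :
    Matrix (Σ k, h k) (Σ k, h k) ℂ :=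
  Matrix.diagonal fun i => if i.1 = k then 1 else 0

/-- The canonical isometric inclusion of `ℂ^{h k}` into `⊕ₖ ℂ^{h k}`. -/
def blockIncl {κ : Type*} (h : κ → Type*) [DecidableEq κ] [∀ k, DecidableEq (h k)] (k : κ) :
    Matrix (Σ k, h k) (h k) ℂ :=
  Matrix.of fun i x => if i = ⟨k, x⟩ then 1 else 0

/-- The tensor product of two spaces of operators on `ℂ^ι` and `ℂ^τ`, as a space of operators on
`ℂ^ι ⊗ ℂ^τ = ℂ^(ι × τ)`: the linear span of the elementary tensors. -/
def tensorAlg {ι τ : Type*} (S : Submodule ℂ (Matrix ι ι ℂ)) (T : Submodule ℂ (Matrix τ τ ℂ)) :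
    Submodule ℂ (Matrix (ι × τ) (ι × τ) ℂ) :=
  Submodule.span ℂ {M | ∃ x ∈ S, ∃ y ∈ T, M = x ⊗ₖ y}

/-- The partial trace over the first tensor factor. -/
def trFst {ι τ : Type*} [Fintype ι] (M : Matrix (ι × τ) (ι × τ) ℂ) : Matrix τ τ ℂ :=
  Matrix.of fun s t => ∑ i, M (i, s) (i, t)

/-- The partial trace over the middle one of three tensor factors. -/
def trMid {μ δ ν : Type*} [Fintype δ] (M : Matrix (μ × δ × ν) (μ × δ × ν) ℂ) :
    Matrix (μ × ν) (μ × ν) ℂ :=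
  Matrix.of fun p q => ∑ d, M (p.1, d, p.2) (q.1, d, q.2)

/-- The partial transpose on the first tensor factor. -/
def transposeFst {δ ν : Type*} (M : Matrix (δ × ν) (δ × ν) ℂ) : Matrix (δ × ν) (δ × ν) ℂ :=
  Matrix.of fun p q => M (q.1, p.2) (p.1, q.2)

/-- The link product `X * Y = Tr_δ [(I_μ ⊗ Y^{T_δ}) (X ⊗ I_ν)]` of an operator `X` on
`ℂ^μ ⊗ ℂ^δ` and an operator `Y` on `ℂ^δ ⊗ ℂ^ν`, the common factor being `ℂ^δ`. -/
def linkProduct {μ δ ν : Type*} [Fintype μ] [Fintype δ] [Fintype ν]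
    [DecidableEq μ] [DecidableEq δ] [DecidableEq ν]
    (X : Matrix (μ × δ) (μ × δ) ℂ) (Y : Matrix (δ × ν) (δ × ν) ℂ) :
    Matrix (μ × ν) (μ × ν) ℂ :=
  trMid (((1 : Matrix μ μ ℂ) ⊗ₖ transposeFst Y) *
    Matrix.reindex (Equiv.prodAssoc μ δ ν) (Equiv.prodAssoc μ δ ν) (X ⊗ₖ (1 : Matrix ν ν ℂ)))

/-- The ampliation `id ⊗ T` of a linear map `T : B(ℂ^ι) → B(ℂ^α)` by `B(ℂ^σ)`. -/
def ampliation {ι α : Type*} (σ : Type*) (T : Matrix ι ι ℂ →ₗ[ℂ] Matrix α α ℂ)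
    (M : Matrix (σ × ι) (σ × ι) ℂ) : Matrix (σ × α) (σ × α) ℂ :=
  Matrix.of fun p q => T (Matrix.of fun x y => M (p.1, x) (q.1, y)) p.2 q.2

/-- `T` is a channel `B(ℂ^ι) → 𝒜`, with `𝒜` a space of operators on `ℂ^α`: a completely positive
trace-preserving linear map with values in `𝒜`. -/
structure IsChannel {ι α : Type*} [Fintype ι] [Fintype α]
    (𝒜 : Submodule ℂ (Matrix α α ℂ)) (T : Matrix ι ι ℂ →ₗ[ℂ] Matrix α α ℂ) : Prop where
  mem : ∀ a, T a ∈ 𝒜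
  completelyPositive : ∀ (s : ℕ) (M : Matrix (Fin s × ι) (Fin s × ι) ℂ),
    M.PosSemidef → (ampliation (Fin s) T M).PosSemidef
  tracePreserving : ∀ a, (T a).trace = a.trace

/-- The Choi matrix `∑ᵢⱼ T(|i⟩⟨j|) ⊗ |i⟩⟨j|` of a linear map `T : B(ℂ^ι) → B(ℂ^α)`. -/
def choi {ι α : Type*} [Fintype ι] [DecidableEq ι] (T : Matrix ι ι ℂ →ₗ[ℂ] Matrix α α ℂ) :
    Matrix (α × ι) (α × ι) ℂ :=
  ∑ i, ∑ j, T (Matrix.single i j 1) ⊗ₖ Matrix.single i j (1 : ℂ)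

/-- The set `𝒞(B(ℂ^ι), 𝒜)` of all Choi matrices of channels `B(ℂ^ι) → 𝒜`. -/
def channelChois (ι : Type*) {α : Type*} [Fintype ι] [DecidableEq ι] [Fintype α]
    (𝒜 : Submodule ℂ (Matrix α α ℂ)) : Set (Matrix (α × ι) (α × ι) ℂ) :=
  {X | ∃ T : Matrix ι ι ℂ →ₗ[ℂ] Matrix α α ℂ, IsChannel 𝒜 T ∧ X = choi T}

/-- The link product over `ℂ^δ` of `X₁ ∈ B(ℂ^α ⊗ ℂ^β ⊗ ℂ^δ)` and `X₀ ∈ B(ℂ^δ ⊗ ℂ^γ)`, written as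
an operator on `ℂ^α ⊗ (ℂ^β ⊗ ℂ^γ)`. -/
def link₃ {α β δ γ : Type*} [Fintype α] [Fintype β] [Fintype δ] [Fintype γ]
    [DecidableEq α] [DecidableEq β] [DecidableEq δ] [DecidableEq γ]
    (X₁ : Matrix (α × β × δ) (α × β × δ) ℂ) (X₀ : Matrix (δ × γ) (δ × γ) ℂ) :
    Matrix (α × β × γ) (α × β × γ) ℂ :=
  Matrix.reindex (Equiv.prodAssoc α β γ) (Equiv.prodAssoc α β γ)
    (linkProduct
      (Matrix.reindex (Equiv.prodAssoc α β δ).symm (Equiv.prodAssoc α β δ).symm X₁) X₀)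

/-- `𝒜 ⊗ ℬ ⊗ 𝒞` for `𝒜 = ⊕ₖ B(ℂ^{a k})`, `ℬ = ⊕ₘ B(ℂ^{b m})`, `𝒞 = ⊕ₙ B(ℂ^{c n})`. -/
def tripleAlg {κ μ ν : Type*} (a : κ → Type*) (b : μ → Type*) (c : ν → Type*)
    [Fintype κ] [Fintype μ] [Fintype ν] [DecidableEq κ] [DecidableEq μ] [DecidableEq ν]
    [∀ k, Fintype (a k)] [∀ m, Fintype (b m)] [∀ n, Fintype (c n)]
    [∀ k, DecidableEq (a k)] [∀ m, DecidableEq (b m)] [∀ n, DecidableEq (c n)] :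
    Submodule ℂ (Matrix ((Σ k, a k) × (Σ m, b m) × (Σ n, c n))
      ((Σ k, a k) × (Σ m, b m) × (Σ n, c n)) ℂ) :=
  tensorAlg (directSumAlg a).toSubalgebra.toSubmodule
    (tensorAlg (directSumAlg b).toSubalgebra.toSubmodule
      (directSumAlg c).toSubalgebra.toSubmodule)

/-- The inclusion of `B(ℂ^α ⊗ ℂ^{b m} ⊗ ℂ^{c n})` into the operators on
`ℂ^α ⊗ (⊕ₘ ℂ^{b m}) ⊗ (⊕ₙ ℂ^{c n})` as the `(m, n)` corner. -/
def cornerIncl {μ ν : Type*} (α : Type*) (b : μ → Type*) (c : ν → Type*)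
    [Fintype α] [DecidableEq α] [DecidableEq μ] [DecidableEq ν]
    [∀ m, Fintype (b m)] [∀ n, Fintype (c n)]
    [∀ m, DecidableEq (b m)] [∀ n, DecidableEq (c n)] (m : μ) (n : ν)
    (Z : Matrix (α × b m × c n) (α × b m × c n) ℂ) :
    Matrix (α × (Σ m, b m) × (Σ n, c n)) (α × (Σ m, b m) × (Σ n, c n)) ℂ :=
  ((1 : Matrix α α ℂ) ⊗ₖ (blockIncl b m ⊗ₖ blockIncl c n)) * Z *
    ((1 : Matrix α α ℂ) ⊗ₖ (blockIncl b m ⊗ₖ blockIncl c n)).conjTranspose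

/-- The data `X₁`, `X₀` with ancilla `ℂ^d` decompose `X`: each `X₀ n` is a positive operator on
`ℂ^d ⊗ ℂ^{c n}`, each `X₁ m n` is the Choi matrix of a channel `B(ℂ^{b m} ⊗ ℂ^d) → 𝒜`, and
`(I ⊗ q_m ⊗ r_n) X = X₁ m n * X₀ n` for all `m`, `n`, where `*` is the link product. -/
structure IsLinkDecomposition {κ μ ν : Type*} (a : κ → Type*) (b : μ → Type*) (c : ν → Type*)
    [Fintype κ] [Fintype μ] [Fintype ν] [DecidableEq κ] [DecidableEq μ] [DecidableEq ν]
    [∀ k, Fintype (a k)] [∀ m, Fintype (b m)] [∀ n, Fintype (c n)]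
    [∀ k, DecidableEq (a k)] [∀ m, DecidableEq (b m)] [∀ n, DecidableEq (c n)]
    (X : Matrix ((Σ k, a k) × (Σ m, b m) × (Σ n, c n))
      ((Σ k, a k) × (Σ m, b m) × (Σ n, c n)) ℂ)
    (d : ℕ)
    (X₁ : ∀ (m : μ) (_ : ν),
      Matrix ((Σ k, a k) × b m × Fin d) ((Σ k, a k) × b m × Fin d) ℂ)
    (X₀ : ∀ n : ν, Matrix (Fin d × c n) (Fin d × c n) ℂ) : Prop where
  pos : ∀ n, (X₀ n).PosSemidef
  channel : ∀ m n,
    X₁ m n ∈ channelChois (b m × Fin d) (directSumAlg a).toSubalgebra.toSubmodule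
  link : ∀ m n,
    ((1 : Matrix (Σ k, a k) (Σ k, a k) ℂ) ⊗ₖ (centralProj b m ⊗ₖ centralProj c n)) * X =
      cornerIncl (Σ k, a k) b c m n (link₃ (X₁ m n) (X₀ n))

end Definitions

end QLink

/-! From (ii) to (i): a channel's Choi matrix `C` has `Tr_A C = I`, so tracing out `A` in `C * Z`
leaves `I ⊗ Tr_D Z` (`trFst_link₃`). Since `X` is block diagonal, its corners `(m, n)` determine it,
and `Y` is the direct sum of the `Tr_D X₀(n)`. Comparing entries gives the final claim as well.

From (i) to (ii): linking with the rank-one operator built from the vectorisation of `S` is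
conjugation by `I ⊗ I ⊗ S` (`link₃_vecMulVec`). Take `S` with `S Sᴴ = Y` and a pseudo-inverse `R` of
it, so that `P = R Y Rᴴ` is a projection with `S (1 - P) = 0`. Compressing `X` by `R` gives a
positive operator with partial trace `I ⊗ P`; adding a multiple of `I ⊗ I ⊗ (1 - P)` corrects this
to the identity and is invisible to `S`. Conjugating back by `S` returns `X`, because `1 - S R`
kills `Y` and hence kills the positive operator `X` (`kronecker_one_mul_eq_zero`). The construction
is `exists_link₃_eq`, applied corner by corner; its rank-one operator depends only on the block of
`Y`, hence only on `n`. -/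

namespace QLink

/-! ### Slices and the partial trace. -/

section PartialTrace

variable {ι τ σ : Type*}

/-- The operator-valued matrix coefficient of `M` at `(i, j)` in the first tensor factor. -/
def slice (M : Matrix (ι × τ) (ι × τ) ℂ) (i j : ι) : Matrix τ τ ℂ :=
  Matrix.of fun s t => M (i, s) (j, t)

theorem trFst_eq_sum_slice [Fintype ι] (M : Matrix (ι × τ) (ι × τ) ℂ) :
    trFst M = ∑ i, slice M i i := by
  ext s t
  simp [trFst, slice, Matrix.sum_apply]

theorem slice_conj [Fintype ι] [DecidableEq ι] [Fintype τ] (K : Matrix σ τ ℂ)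
    (M : Matrix (ι × τ) (ι × τ) ℂ) (i j : ι) :
    slice (((1 : Matrix ι ι ℂ) ⊗ₖ K) * M * ((1 : Matrix ι ι ℂ) ⊗ₖ K).conjTranspose) i j =
      K * slice M i j * K.conjTranspose := by
  ext s t
  simp only [slice, Matrix.of_apply, Matrix.mul_apply, Matrix.conjTranspose_apply,
    Matrix.kroneckerMap_apply, Fintype.sum_prod_type, Matrix.one_apply, ite_mul, one_mul, zero_mul,
    apply_ite star, star_zero, mul_ite, mul_zero]
  rw [Finset.sum_eq_single j]
  · simp
  · intro b _ hb
    simp [Ne.symm hb]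
  · simp

theorem trFst_conj [Fintype ι] [DecidableEq ι] [Fintype τ] (K : Matrix σ τ ℂ)
    (M : Matrix (ι × τ) (ι × τ) ℂ) :
    trFst (((1 : Matrix ι ι ℂ) ⊗ₖ K) * M * ((1 : Matrix ι ι ℂ) ⊗ₖ K).conjTranspose) =
      K * trFst M * K.conjTranspose := by
  simp only [trFst_eq_sum_slice, slice_conj, Matrix.mul_sum, Matrix.sum_mul]

theorem trace_trFst [Fintype ι] [Fintype τ] (M : Matrix (ι × τ) (ι × τ) ℂ) :
    (trFst M).trace = M.trace := by
  simp only [Matrix.trace, trFst, Matrix.diag, Matrix.of_apply, Fintype.sum_prod_type]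
  exact Finset.sum_comm

theorem posSemidef_trFst [Fintype ι] {M : Matrix (ι × τ) (ι × τ) ℂ} (hM : M.PosSemidef) :
    (trFst M).PosSemidef := by
  rw [trFst_eq_sum_slice]
  exact Matrix.posSemidef_sum _ fun i _ => hM.submatrix fun t => (i, t)

end PartialTrace

/-! ### The link product in coordinates. -/

section Link

variable {α β γ δ : Type*} [Fintype α] [Fintype β] [Fintype γ] [Fintype δ]
  [DecidableEq α] [DecidableEq β] [DecidableEq γ] [DecidableEq δ]

theorem link₃_apply (C : Matrix (α × β × δ) (α × β × δ) ℂ) (Z : Matrix (δ × γ) (δ × γ) ℂ)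
    (p q : α × β × γ) :
    link₃ C Z p q = ∑ d, ∑ e,
      C (p.1, p.2.1, e) (q.1, q.2.1, d) * Z (e, p.2.2) (d, q.2.2) := by
  obtain ⟨x, y, z⟩ := p
  obtain ⟨x', y', z'⟩ := q
  simp only [link₃, linkProduct, trMid, Matrix.reindex_apply, Matrix.submatrix_apply,
    Matrix.of_apply, Matrix.mul_apply, Matrix.kroneckerMap_apply, transposeFst]
  refine Finset.sum_congr rfl fun d _ => ?_
  rw [Fintype.sum_prod_type, Finset.sum_eq_single (x, y)]
  · rw [Fintype.sum_prod_type]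
    refine Finset.sum_congr rfl fun e _ => ?_
    rw [Finset.sum_eq_single z']
    · simp [mul_comm, Matrix.one_apply, Equiv.prodAssoc_symm_apply]
    · intro b _ hb
      simp [Matrix.one_apply, hb]
    · simp
  · intro b _ hb
    refine Finset.sum_eq_zero fun c _ => ?_
    simp [Matrix.one_apply, Ne.symm hb]
  · simp

/-- Summing over the `α` index turns `C` into a Kronecker delta on `β × δ`, which contracts the two
`δ` indices of `Z` into a trace. -/
theorem trFst_link₃ {C : Matrix (α × β × δ) (α × β × δ) ℂ} (hC : trFst C = 1)
    (Z : Matrix (δ × γ) (δ × γ) ℂ) :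
    trFst (link₃ C Z) = (1 : Matrix β β ℂ) ⊗ₖ trFst Z := by
  ext ⟨y, z⟩ ⟨y', z'⟩
  have h : ∀ e d, ∑ x, C (x, y, e) (x, y', d) = if (y, e) = (y', d) then 1 else 0 := by
    intro e d
    have := congrFun (congrFun hC (y, e)) (y', d)
    rwa [Matrix.one_apply] at this
  simp only [trFst, Matrix.of_apply, link₃_apply, Matrix.kroneckerMap_apply]
  rw [Finset.sum_comm]
  simp_rw [Finset.sum_comm (s := (Finset.univ : Finset α)), ← Finset.sum_mul, h, Prod.mk.injEq]
  by_cases hy : y = y' <;> simp [hy, Matrix.one_apply]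

/-- A rank-one second factor splits the double sum over `δ` into a left multiplication by `S` and a
right multiplication by `Sᴴ`. -/
theorem link₃_vecMulVec (C : Matrix (α × β × δ) (α × β × δ) ℂ) (S : Matrix γ δ ℂ) :
    link₃ C (Matrix.vecMulVec (fun p : δ × γ => S p.2 p.1) (star fun p : δ × γ => S p.2 p.1)) =
      ((1 : Matrix α α ℂ) ⊗ₖ ((1 : Matrix β β ℂ) ⊗ₖ S)) * C *
        ((1 : Matrix α α ℂ) ⊗ₖ ((1 : Matrix β β ℂ) ⊗ₖ S)).conjTranspose := by
  ext ⟨x, y, z⟩ ⟨x', y', z'⟩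
  have h1 := congrFun (congrFun
    (slice_conj ((1 : Matrix β β ℂ) ⊗ₖ S) C x x') (y, z)) (y', z')
  have h2 := congrFun (congrFun (slice_conj S (slice C x x') y y') z) z'
  refine Eq.trans ?_ (h2.symm.trans h1.symm)
  rw [link₃_apply]
  simp only [slice, Matrix.vecMulVec_apply, Pi.star_apply, Matrix.mul_apply, Matrix.of_apply,
    Matrix.conjTranspose_apply, Finset.sum_mul]
  exact Finset.sum_congr rfl fun d _ => Finset.sum_congr rfl fun e _ => by ring

end Link

/-! ### Choi matrices and channels. -/

section Choi

variable {ι α : Type*} [Fintype ι] [DecidableEq ι]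

theorem choi_apply (T : Matrix ι ι ℂ →ₗ[ℂ] Matrix α α ℂ) (p q : α × ι) :
    choi T p q = T (Matrix.single p.2 q.2 1) p.1 q.1 := by
  simp only [choi, Matrix.sum_apply, Matrix.kroneckerMap_apply]
  rw [Finset.sum_eq_single p.2, Finset.sum_eq_single q.2]
  · simp
  · intro b _ hb
    simp [hb]
  · simp
  · intro b _ hb
    simp [hb]
  · simp

theorem trFst_eq_one_of_mem_channelChois [Fintype α] {𝒜 : Submodule ℂ (Matrix α α ℂ)}
    {C : Matrix (α × ι) (α × ι) ℂ} (hC : C ∈ channelChois ι 𝒜) : trFst C = 1 := by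
  obtain ⟨T, hT, rfl⟩ := hC
  ext i j
  have h := hT.tracePreserving (Matrix.single i j 1)
  simp only [trFst, Matrix.of_apply, choi_apply]
  refine h.trans ?_
  by_cases hij : i = j
  · subst hij
    simp
  · simp [hij, Matrix.trace_single_eq_of_ne]

/-- The linear map whose Choi matrix is `C`. -/
def ofChoi (C : Matrix (α × ι) (α × ι) ℂ) : Matrix ι ι ℂ →ₗ[ℂ] Matrix α α ℂ where
  toFun a := ∑ i, ∑ j, a i j • Matrix.of fun x y => C (x, i) (y, j)
  map_add' a b := by simp only [Matrix.add_apply, add_smul, Finset.sum_add_distrib]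
  map_smul' r a := by simp [Finset.smul_sum, mul_smul]

omit [DecidableEq ι] in
theorem ofChoi_apply (C : Matrix (α × ι) (α × ι) ℂ) (a : Matrix ι ι ℂ) (x y : α) :
    ofChoi C a x y = ∑ i, ∑ j, a i j * C (x, i) (y, j) := by
  simp [ofChoi, Matrix.sum_apply]

theorem choi_ofChoi (C : Matrix (α × ι) (α × ι) ℂ) : choi (ofChoi C) = C := by
  ext ⟨x, i⟩ ⟨y, j⟩
  rw [choi_apply, ofChoi_apply]
  simp [Matrix.single_apply, ite_and]

theorem posSemidef_ampliation_ofChoi [Fintype α] {σ : Type*} [Fintype σ] {C : Matrix (α × ι) (α × ι) ℂ}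
    (hC : C.PosSemidef) {M : Matrix (σ × ι) (σ × ι) ℂ} (hM : M.PosSemidef) :
    (ampliation σ (ofChoi C) M).PosSemidef := by
  classical
  -- `E` pairs the two `ι` factors with the unnormalised maximally entangled vector, which exhibits
  -- the ampliation as a compression of `M ⊗ C`.
  let E : Matrix (σ × α) ((σ × ι) × (α × ι)) ℂ := Matrix.of fun p q =>
    if q.1.1 = p.1 then if q.2.1 = p.2 then if q.1.2 = q.2.2 then 1 else 0 else 0 else 0
  have h : ampliation σ (ofChoi C) M = E * (M ⊗ₖ C) * E.conjTranspose := by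
    ext ⟨s, x⟩ ⟨t, y⟩
    simp only [ampliation, Matrix.of_apply, ofChoi_apply, Matrix.mul_apply,
      Matrix.conjTranspose_apply, Matrix.kroneckerMap_apply, Fintype.sum_prod_type, E,
      apply_ite star, star_one, star_zero, mul_ite, mul_one, mul_zero, ite_mul, one_mul, zero_mul,
      Finset.sum_ite_eq, Finset.sum_ite_eq', Finset.mem_univ, if_true, Finset.sum_const_zero,
      Finset.sum_ite_irrel]
    exact Finset.sum_comm
  rw [h]
  exact (hM.kronecker hC).mul_mul_conjTranspose_same E

/-- The direction of Choi's theorem needed to build channels: positivity gives complete positivity,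
the partial trace condition gives trace preservation, and membership of the coefficients in `𝒜`
gives the range. -/
theorem mem_channelChois [Fintype α] {𝒜 : Submodule ℂ (Matrix α α ℂ)}
    {C : Matrix (α × ι) (α × ι) ℂ} (hC : C.PosSemidef) (htr : trFst C = 1)
    (hmem : ∀ i j, (Matrix.of fun x y => C (x, i) (y, j)) ∈ 𝒜) : C ∈ channelChois ι 𝒜 := by
  refine ⟨ofChoi C, ⟨fun a => ?_, fun s M hM => posSemidef_ampliation_ofChoi hC hM,
    fun a => ?_⟩, (choi_ofChoi C).symm⟩
  · exact Submodule.sum_mem _ fun i _ => Submodule.sum_mem _ fun j _ =>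
      Submodule.smul_mem _ _ (hmem i j)
  · have h : ∀ i j, ∑ x, C (x, i) (x, j) = if i = j then 1 else 0 := by
      intro i j
      have := congrFun (congrFun htr i) j
      rwa [Matrix.one_apply] at this
    simp only [Matrix.trace, Matrix.diag, ofChoi_apply]
    rw [Finset.sum_comm]
    simp_rw [Finset.sum_comm (s := (Finset.univ : Finset α)), ← Finset.mul_sum, h]
    simp

end Choi

/-! ### Purification of `Y` and the decomposition of a single corner. -/

section Decomposition

theorem _root_.Matrix.PosSemidef.exists_eq_conjTranspose_mul_self {n : Type*} [Fintype n]
    {M : Matrix n n ℂ} (hM : M.PosSemidef) : ∃ B : Matrix n n ℂ, M = B.conjTranspose * B := by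
  classical
  open scoped MatrixOrder in
  exact CStarAlgebra.nonneg_iff_eq_star_mul_self.mp hM.nonneg

theorem mul_mul_of_mul_eq_one {l m n : Type*} [Fintype l] [Fintype m] [DecidableEq l]
    {A : Matrix l m ℂ} {B : Matrix m l ℂ} (h : A * B = 1) (Z : Matrix l n ℂ) :
    A * (B * Z) = Z := by
  rw [← Matrix.mul_assoc, h, Matrix.one_mul]

/-- A positive operator `Y` factors as `S * Sᴴ` through any space at least as large, and `S` has a
one-sided pseudo-inverse `R`. -/
theorem exists_purification {γ δ : Type*} [Fintype γ] [Fintype δ] [DecidableEq γ] [DecidableEq δ]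
    (f : γ ↪ δ) {Y : Matrix γ γ ℂ} (hY : Y.PosSemidef) :
    ∃ (S : Matrix γ δ ℂ) (R : Matrix δ γ ℂ), S * S.conjTranspose = Y ∧
      (1 - R * Y * R.conjTranspose).PosSemidef ∧ S * (1 - R * Y * R.conjTranspose) = 0 ∧
      (1 - S * R) * Y = 0 := by
  let U : Matrix γ γ ℂ := hY.1.eigenvectorUnitary
  let l : γ → ℝ := hY.1.eigenvalues
  have hl : ∀ i, 0 ≤ l i := hY.eigenvalues_nonneg
  -- The isometry `ℂ^γ → ℂ^δ` induced by `f`.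
  let J : Matrix δ γ ℂ := Matrix.of fun d i => if d = f i then 1 else 0
  have hU : U.conjTranspose * U = 1 := Unitary.coe_star_mul_self hY.1.eigenvectorUnitary
  have hJ : J.conjTranspose * J = 1 := by
    ext i j
    simp [J, Matrix.mul_apply, Matrix.one_apply, eq_comm]
  let s : γ → ℂ := fun i => (√(l i) : ℝ)
  -- Since `0⁻¹ = 0`, this is the pseudo-inverse of `s`, and `r * s` is the indicator of the nonzero
  -- eigenvalues.
  let r : γ → ℂ := fun i => (s i)⁻¹
  let P : Matrix γ γ ℂ := Matrix.diagonal fun i => r i * s i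
  have hs : (Matrix.diagonal s).conjTranspose = Matrix.diagonal s := by
    rw [Matrix.diagonal_conjTranspose]
    congr 1
    ext i
    simp [s]
  have hr : (Matrix.diagonal r).conjTranspose = Matrix.diagonal r := by
    rw [Matrix.diagonal_conjTranspose]
    congr 1
    ext i
    simp [r, s]
  have hYs : Y = U * (Matrix.diagonal s * Matrix.diagonal s) * U.conjTranspose := by
    refine (hY.1.spectral_theorem).trans ?_
    rw [Unitary.conjStarAlgAut_apply, Matrix.diagonal_mul_diagonal]
    congr 3
    ext i
    simp only [s, Function.comp]
    rw [← Complex.ofReal_mul, Real.mul_self_sqrt (hl i)]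
    rfl
  have hrs : Matrix.diagonal r * Matrix.diagonal s = P := Matrix.diagonal_mul_diagonal _ _
  have hsr : Matrix.diagonal s * Matrix.diagonal r = P := by
    rw [Matrix.diagonal_mul_diagonal]
    exact congrArg _ (funext fun i => mul_comm _ _)
  have hPP : P * P = P := by
    simp only [P, Matrix.diagonal_mul_diagonal]
    refine congrArg _ (funext fun i => ?_)
    by_cases h : s i = 0 <;> simp [r, h]
  have hsP : Matrix.diagonal s * P = Matrix.diagonal s := by
    simp only [P, Matrix.diagonal_mul_diagonal]
    refine congrArg _ (funext fun i => ?_)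
    by_cases h : s i = 0 <;> simp [r, h]
  have hPs : P * Matrix.diagonal s = Matrix.diagonal s := by
    simp only [P, Matrix.diagonal_mul_diagonal]
    refine congrArg _ (funext fun i => ?_)
    by_cases h : s i = 0 <;> simp [r, h]
  have hPh : P.conjTranspose = P := by
    rw [← hrs, Matrix.conjTranspose_mul, hr, hs, hsr, hrs]
  have hRYR : (J * Matrix.diagonal r * U.conjTranspose) * Y *
      (J * Matrix.diagonal r * U.conjTranspose).conjTranspose = J * P * J.conjTranspose := by
    have h : Matrix.diagonal r * (Matrix.diagonal s * (Matrix.diagonal s * Matrix.diagonal r)) =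
        P := by
      rw [← Matrix.mul_assoc, hrs, hsr, hPP]
    rw [hYs]
    simp only [Matrix.conjTranspose_mul, Matrix.conjTranspose_conjTranspose, hr, Matrix.mul_assoc,
      mul_mul_of_mul_eq_one hU]
    rw [← h]
    simp only [Matrix.mul_assoc]
  refine ⟨U * Matrix.diagonal s * J.conjTranspose, J * Matrix.diagonal r * U.conjTranspose,
    ?_, ?_, ?_, ?_⟩
  · rw [hYs]
    simp only [Matrix.conjTranspose_mul, Matrix.conjTranspose_conjTranspose, hs, Matrix.mul_assoc,
      mul_mul_of_mul_eq_one hJ]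
  · rw [hRYR]
    -- `J P Jᴴ` is a self-adjoint idempotent, hence so is its complement, which is therefore
    -- positive.
    have h : (1 - J * P * J.conjTranspose) =
        (1 - J * P * J.conjTranspose).conjTranspose * (1 - J * P * J.conjTranspose) := by
      have h2 : (J * P * J.conjTranspose) * (J * P * J.conjTranspose) = J * P * J.conjTranspose := by
        simp only [Matrix.mul_assoc, mul_mul_of_mul_eq_one hJ]
        rw [← Matrix.mul_assoc P P, hPP]
      simp only [Matrix.conjTranspose_sub, Matrix.conjTranspose_one, Matrix.conjTranspose_mul,
        Matrix.conjTranspose_conjTranspose, hPh, ← Matrix.mul_assoc J P]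
      rw [Matrix.mul_sub, Matrix.sub_mul, Matrix.sub_mul, h2]
      simp
    rw [h]
    exact Matrix.posSemidef_conjTranspose_mul_self _
  · rw [hRYR]
    simp only [Matrix.mul_sub, Matrix.mul_one, Matrix.mul_assoc, mul_mul_of_mul_eq_one hJ]
    rw [← Matrix.mul_assoc (Matrix.diagonal s) P, hsP, sub_self]
  · have h : Matrix.diagonal s * (Matrix.diagonal r * (Matrix.diagonal s *
        (Matrix.diagonal s * U.conjTranspose))) =
        Matrix.diagonal s * (Matrix.diagonal s * U.conjTranspose) := by
      rw [← Matrix.mul_assoc, hsr, ← Matrix.mul_assoc P, hPs]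
    rw [Matrix.sub_mul, Matrix.one_mul, hYs]
    simp only [Matrix.mul_assoc, mul_mul_of_mul_eq_one hJ, mul_mul_of_mul_eq_one hU, h,
      sub_self]

/-- With `K = I ⊗ I ⊗ N`, the positive operator `K X Kᴴ` has trace `Tr (I ⊗ N Y Nᴴ) = 0`, so it
vanishes. Writing `X = Bᴴ B` gives `K Bᴴ = 0`, hence `K X = 0`. -/
theorem kronecker_one_mul_eq_zero {α β γ : Type*} [Fintype α] [Fintype β] [Fintype γ]
    [DecidableEq α] [DecidableEq β]
    {X : Matrix (α × β × γ) (α × β × γ) ℂ} (hX : X.PosSemidef) {Y : Matrix γ γ ℂ}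
    (hXY : trFst X = (1 : Matrix β β ℂ) ⊗ₖ Y) {N : Matrix γ γ ℂ} (hN : N * Y = 0) :
    ((1 : Matrix α α ℂ) ⊗ₖ ((1 : Matrix β β ℂ) ⊗ₖ N)) * X = 0 := by
  obtain ⟨B, rfl⟩ := hX.exists_eq_conjTranspose_mul_self
  set K := (1 : Matrix α α ℂ) ⊗ₖ ((1 : Matrix β β ℂ) ⊗ₖ N) with hK
  have h : K * (B.conjTranspose * B) * K.conjTranspose = 0 := by
    rw [← (hX.mul_mul_conjTranspose_same K).trace_eq_zero_iff, ← trace_trFst, hK, trFst_conj, hXY,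
      ← Matrix.mul_kronecker_mul, hN, Matrix.kronecker_zero, Matrix.zero_mul, Matrix.trace_zero]
  have h2 : (K * B.conjTranspose) * (K * B.conjTranspose).conjTranspose = 0 := by
    rw [← h]
    simp only [Matrix.conjTranspose_mul, Matrix.conjTranspose_conjTranspose, Matrix.mul_assoc]
  rw [← Matrix.mul_assoc, Matrix.self_mul_conjTranspose_eq_zero.mp h2, Matrix.zero_mul]

/-- Positive operators `X` with `Tr_α X = I ⊗ Y` are link products of a Choi matrix with an operator
`Z` that depends only on `Y`. -/
theorem exists_link₃_eq {γ δ : Type*} [Fintype γ] [Fintype δ] [DecidableEq γ] [DecidableEq δ]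
    (f : γ ↪ δ) {Y : Matrix γ γ ℂ} (hY : Y.PosSemidef) :
    ∃ Z : Matrix (δ × γ) (δ × γ) ℂ, Z.PosSemidef ∧
      ∀ {α β : Type*} [Fintype α] [Fintype β] [DecidableEq α] [DecidableEq β] [Nonempty α]
        {X : Matrix (α × β × γ) (α × β × γ) ℂ}, X.PosSemidef →
        trFst X = (1 : Matrix β β ℂ) ⊗ₖ Y →
        ∃ C : Matrix (α × β × δ) (α × β × δ) ℂ, C.PosSemidef ∧ trFst C = 1 ∧ link₃ C Z = X ∧
          ∀ i j, i ≠ j → slice X i j = 0 → slice C i j = 0 := by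
  obtain ⟨S, R, hS, hP, hSP, hSR⟩ := exists_purification f hY
  -- The witness `Z` is fixed before `α`, `β` and `X`, so one operator serves all of them.
  refine ⟨_, Matrix.posSemidef_vecMulVec_self_star fun p : δ × γ => S p.2 p.1, ?_⟩
  intro α β _ _ _ _ _ X hX hXY
  set P := R * Y * R.conjTranspose with hPdef
  set G := (1 : Matrix β β ℂ) ⊗ₖ R with hG
  set K := (1 : Matrix β β ℂ) ⊗ₖ S with hK
  have hfix : ((1 : Matrix α α ℂ) ⊗ₖ (K * G)) * X = X := by
    have h := kronecker_one_mul_eq_zero hX hXY hSR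
    have h2 : (1 : Matrix β β ℂ) ⊗ₖ (1 - S * R) = 1 - K * G := by
      rw [hK, hG, ← Matrix.mul_kronecker_mul, Matrix.one_mul, ← Matrix.one_kronecker_one,
        sub_eq_add_neg, Matrix.kronecker_add, sub_eq_add_neg, ← neg_one_smul ℂ (S * R),
        Matrix.kronecker_smul, neg_one_smul]
    have h3 : (1 : Matrix α α ℂ) ⊗ₖ (1 - K * G) = 1 - (1 : Matrix α α ℂ) ⊗ₖ (K * G) := by
      rw [← Matrix.one_kronecker_one (α := ℂ) (m := α) (n := β × γ),
        sub_eq_add_neg, Matrix.kronecker_add, sub_eq_add_neg, ← neg_one_smul ℂ (K * G),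
        Matrix.kronecker_smul, neg_one_smul]
    rw [h2, h3, Matrix.sub_mul, Matrix.one_mul, sub_eq_zero] at h
    exact h.symm
  have hKP : K * ((1 : Matrix β β ℂ) ⊗ₖ (1 - P)) = 0 := by
    rw [hK, ← Matrix.mul_kronecker_mul, hSP, Matrix.kronecker_zero]
  set W := (1 : Matrix α α ℂ) ⊗ₖ ((1 : Matrix β β ℂ) ⊗ₖ (1 - P)) with hW
  have hsliceW : ∀ i j, slice W i j = (1 : Matrix α α ℂ) i j • ((1 : Matrix β β ℂ) ⊗ₖ (1 - P)) :=
    fun i j => rfl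
  have hsliceAdd : ∀ (A B : Matrix (α × β × δ) (α × β × δ) ℂ) i j,
      slice (A + B) i j = slice A i j + slice B i j := fun _ _ _ _ => rfl
  have hsliceSmul : ∀ (r : ℂ) (A : Matrix (α × β × δ) (α × β × δ) ℂ) i j,
      slice (r • A) i j = r • slice A i j := fun _ _ _ _ => rfl
  -- The second summand fills the defect `I ⊗ (1 - P)` of the partial trace; the factor `1 / card α`
  -- compensates for the trace of the identity on `ℂ^α`.
  refine ⟨((1 : Matrix α α ℂ) ⊗ₖ G) * X * ((1 : Matrix α α ℂ) ⊗ₖ G).conjTranspose +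
    (Fintype.card α : ℂ)⁻¹ • W, ?_, ?_, ?_, ?_⟩
  · refine (hX.mul_mul_conjTranspose_same _).add (Matrix.PosSemidef.smul ?_ ?_)
    · exact Matrix.PosSemidef.one.kronecker (Matrix.PosSemidef.one.kronecker hP)
    · exact inv_nonneg.mpr (Nat.cast_nonneg _)
  · have h : trFst (((1 : Matrix α α ℂ) ⊗ₖ G) * X * ((1 : Matrix α α ℂ) ⊗ₖ G).conjTranspose) =
        (1 : Matrix β β ℂ) ⊗ₖ P := by
      rw [trFst_conj, hXY, hG, Matrix.conjTranspose_kronecker, ← Matrix.mul_kronecker_mul,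
        ← Matrix.mul_kronecker_mul, ← hPdef]
      simp
    rw [trFst_eq_sum_slice] at h ⊢
    simp only [hsliceAdd, hsliceSmul, Finset.sum_add_distrib, h, hsliceW, Matrix.one_apply_eq,
      one_smul, Finset.sum_const, Finset.card_univ]
    rw [← Nat.cast_smul_eq_nsmul ℂ, smul_smul,
      mul_inv_cancel₀ (Nat.cast_ne_zero.mpr Fintype.card_ne_zero), one_smul,
      ← Matrix.kronecker_add, add_sub_cancel, Matrix.one_kronecker_one]
  · rw [link₃_vecMulVec, ← hK, Matrix.mul_add, Matrix.add_mul, Matrix.mul_smul, hW,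
      ← Matrix.mul_kronecker_mul, hKP, Matrix.kronecker_zero, smul_zero, Matrix.zero_mul, add_zero]
    have h : ((1 : Matrix α α ℂ) ⊗ₖ K) * ((1 : Matrix α α ℂ) ⊗ₖ G) =
        (1 : Matrix α α ℂ) ⊗ₖ (K * G) := by
      rw [← Matrix.mul_kronecker_mul, Matrix.one_mul]
    have h2 := congrArg Matrix.conjTranspose hfix
    rw [Matrix.conjTranspose_mul, hX.1.eq] at h2
    calc _ = (((1 : Matrix α α ℂ) ⊗ₖ (K * G)) * X) *
          ((1 : Matrix α α ℂ) ⊗ₖ (K * G)).conjTranspose := by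
          rw [← h, Matrix.conjTranspose_mul]
          simp only [Matrix.mul_assoc]
      _ = X := by rw [hfix, h2]
  -- The correction is the identity on `ℂ^α`, so it contributes nothing to off-diagonal slices.
  · intro i j hij hX0
    rw [hsliceAdd, hsliceSmul, slice_conj, hX0, hsliceW, Matrix.one_apply_ne hij]
    simp

end Decomposition

/-! ### Block structure of tensor products and direct sums. -/

section Blocks

theorem tensorAlg_apply_eq_zero {ι τ : Type*} {S : Submodule ℂ (Matrix ι ι ℂ)}
    {T : Submodule ℂ (Matrix τ τ ℂ)} {p q : ι × τ}
    (h : (∀ x ∈ S, x p.1 q.1 = 0) ∨ ∀ y ∈ T, y p.2 q.2 = 0)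
    {M : Matrix (ι × τ) (ι × τ) ℂ} (hM : M ∈ tensorAlg S T) : M p q = 0 := by
  induction hM using Submodule.span_induction with
  | mem M hM =>
    obtain ⟨x, hx, y, hy, rfl⟩ := hM
    rw [Matrix.kroneckerMap_apply]
    rcases h with h | h
    · rw [h x hx, zero_mul]
    · rw [h y hy, mul_zero]
  | zero => rfl
  | add A B _ _ hA hB => rw [Matrix.add_apply, hA, hB, add_zero]
  | smul r A _ hA => rw [Matrix.smul_apply, hA, smul_zero]

variable {ν : Type*} (c : ν → Type*) [DecidableEq ν] [∀ n, DecidableEq (c n)]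

theorem blockIncl_conj_apply [∀ n, Fintype (c n)] (n : ν) (Z : Matrix (c n) (c n) ℂ)
    (y z : c n) :
    (blockIncl c n * Z * (blockIncl c n).conjTranspose) ⟨n, y⟩ ⟨n, z⟩ = Z y z := by
  simp [blockIncl, Matrix.mul_apply]

theorem blockIncl_conj_apply_of_ne [∀ n, Fintype (c n)] {n : ν} (Z : Matrix (c n) (c n) ℂ)
    {i j : Σ n, c n} (h : i.1 ≠ n ∨ j.1 ≠ n) :
    (blockIncl c n * Z * (blockIncl c n).conjTranspose) i j = 0 := by
  rcases h with h | h
  · have h' : ∀ y : c n, i ≠ ⟨n, y⟩ := fun y hy => h (congrArg Sigma.fst hy)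
    simp [blockIncl, Matrix.mul_apply, h']
  · have h' : ∀ y : c n, j ≠ ⟨n, y⟩ := fun y hy => h (congrArg Sigma.fst hy)
    simp [blockIncl, Matrix.mul_apply, h']

theorem blockIncl_mul_conjTranspose [∀ n, Fintype (c n)] (n : ν) :
    blockIncl c n * (blockIncl c n).conjTranspose = centralProj c n := by
  ext ⟨i, y⟩ ⟨j, z⟩
  by_cases hi : i = n
  · subst hi
    by_cases hj : j = i
    · subst hj
      simp [blockIncl, centralProj, Matrix.mul_apply, Matrix.diagonal_apply, eq_comm]
    · simp [blockIncl, centralProj, Matrix.mul_apply, hj, Ne.symm hj]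
  · simp [blockIncl, centralProj, Matrix.mul_apply, Matrix.diagonal_apply, hi]

theorem conjTranspose_mul_blockIncl [Fintype ν] [∀ n, Fintype (c n)] (n : ν) :
    (blockIncl c n).conjTranspose * blockIncl c n = 1 := by
  ext y z
  simp [blockIncl, Matrix.mul_apply, Matrix.one_apply, eq_comm]

end Blocks

/-! ### Assembling the corners `(m, n)`. -/

section Corners

variable {κ μ ν : Type*} (a : κ → Type*) (b : μ → Type*) (c : ν → Type*)
    [Fintype κ] [Fintype μ] [Fintype ν] [DecidableEq κ] [DecidableEq μ] [DecidableEq ν]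
    [∀ k, Fintype (a k)] [∀ m, Fintype (b m)] [∀ n, Fintype (c n)]
    [∀ k, DecidableEq (a k)] [∀ m, DecidableEq (b m)] [∀ n, DecidableEq (c n)]

theorem tripleAlg_apply_eq_zero {X : Matrix ((Σ k, a k) × (Σ m, b m) × (Σ n, c n))
      ((Σ k, a k) × (Σ m, b m) × (Σ n, c n)) ℂ} (hX : X ∈ tripleAlg a b c)
    {p q : (Σ k, a k) × (Σ m, b m) × (Σ n, c n)}
    (h : p.1.1 ≠ q.1.1 ∨ p.2.1.1 ≠ q.2.1.1 ∨ p.2.2.1 ≠ q.2.2.1) : X p q = 0 := by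
  refine tensorAlg_apply_eq_zero (p := p) (q := q) ?_ hX
  rcases h with h | h
  · exact Or.inl fun x hx => hx _ _ h
  · refine Or.inr fun y hy => tensorAlg_apply_eq_zero (p := p.2) (q := q.2) ?_ hy
    rcases h with h | h
    · exact Or.inl fun x hx => hx _ _ h
    · exact Or.inr fun x hx => hx _ _ h

/-- The inclusion of the basis of the `(m, n)` corner. -/
def cornerMap (α : Type*) {μ ν : Type*} (b : μ → Type*) (c : ν → Type*) (m : μ) (n : ν)
    (p : α × b m × c n) : α × (Σ m, b m) × (Σ n, c n) :=
  (p.1, ⟨m, p.2.1⟩, ⟨n, p.2.2⟩)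

theorem conjTranspose_blockIncl_mul_mul (α : Type*) [Fintype α] [DecidableEq α] (m : μ) (n : ν)
    (X : Matrix (α × (Σ m, b m) × (Σ n, c n)) (α × (Σ m, b m) × (Σ n, c n)) ℂ) :
    ((1 : Matrix α α ℂ) ⊗ₖ (blockIncl b m ⊗ₖ blockIncl c n)).conjTranspose * X *
        ((1 : Matrix α α ℂ) ⊗ₖ (blockIncl b m ⊗ₖ blockIncl c n)) =
      X.submatrix (cornerMap α b c m n) (cornerMap α b c m n) := by
  have h : (1 : Matrix α α ℂ) ⊗ₖ (blockIncl b m ⊗ₖ blockIncl c n) =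
      Matrix.of fun r p => if r = cornerMap α b c m n p then 1 else 0 := by
    ext ⟨x, y, z⟩ ⟨x', y', z'⟩
    simp only [Matrix.kroneckerMap_apply, blockIncl, Matrix.of_apply, Matrix.one_apply, cornerMap,
      Prod.mk.injEq, ite_and]
    split_ifs <;> simp
  ext p q
  simp [h, Matrix.mul_apply]

/-- Turns the link equation into an equality of ordinary submatrices: as `X` is block diagonal,
cutting on the left by the central projection `V Vᴴ` already cuts on both sides, and `Vᴴ V = 1`
makes conjugation by `V` reversible. -/
theorem centralProj_mul_eq_cornerIncl_iff {X : Matrix ((Σ k, a k) × (Σ m, b m) × (Σ n, c n))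
      ((Σ k, a k) × (Σ m, b m) × (Σ n, c n)) ℂ} (hX : X ∈ tripleAlg a b c) (m : μ) (n : ν)
    (W : Matrix ((Σ k, a k) × b m × c n) ((Σ k, a k) × b m × c n) ℂ) :
    ((1 : Matrix (Σ k, a k) (Σ k, a k) ℂ) ⊗ₖ (centralProj b m ⊗ₖ centralProj c n)) * X =
      cornerIncl (Σ k, a k) b c m n W ↔
    X.submatrix (cornerMap _ b c m n) (cornerMap _ b c m n) = W := by
  have hEX : ((1 : Matrix (Σ k, a k) (Σ k, a k) ℂ) ⊗ₖ (centralProj b m ⊗ₖ centralProj c n)) * X =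
      ((1 : Matrix (Σ k, a k) (Σ k, a k) ℂ) ⊗ₖ (centralProj b m ⊗ₖ centralProj c n)) * X *
      ((1 : Matrix (Σ k, a k) (Σ k, a k) ℂ) ⊗ₖ (centralProj b m ⊗ₖ centralProj c n)) := by
    simp only [centralProj, Matrix.diagonal_kronecker_diagonal, ← Matrix.diagonal_one]
    ext p q
    rw [Matrix.mul_diagonal, Matrix.diagonal_mul]
    by_cases h : p.2.1.1 = q.2.1.1 ∧ p.2.2.1 = q.2.2.1
    · rw [h.1, h.2]
      split_ifs <;> simp
    · rw [tripleAlg_apply_eq_zero a b c hX (Or.inr (not_and_or.mp h))]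
      simp
  rw [← conjTranspose_blockIncl_mul_mul]
  set V := (1 : Matrix (Σ k, a k) (Σ k, a k) ℂ) ⊗ₖ (blockIncl b m ⊗ₖ blockIncl c n) with hV
  have hVV : V * V.conjTranspose =
      (1 : Matrix (Σ k, a k) (Σ k, a k) ℂ) ⊗ₖ (centralProj b m ⊗ₖ centralProj c n) := by
    simp only [hV, Matrix.conjTranspose_kronecker, ← Matrix.mul_kronecker_mul,
      blockIncl_mul_conjTranspose, Matrix.conjTranspose_one, Matrix.one_mul]
  have hVV1 : V.conjTranspose * V = 1 := by
    simp only [hV, Matrix.conjTranspose_kronecker, ← Matrix.mul_kronecker_mul,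
      conjTranspose_mul_blockIncl, Matrix.conjTranspose_one, Matrix.one_mul,
      Matrix.one_kronecker_one]
  rw [← hVV] at hEX ⊢
  constructor
  · intro h
    have h2 := congrArg (fun M => V.conjTranspose * M * V) h
    simpa only [cornerIncl, ← hV, Matrix.mul_assoc, mul_mul_of_mul_eq_one hVV1, hVV1,
      Matrix.mul_one] using h2
  · rintro rfl
    rw [hEX, cornerIncl, ← hV]
    simp only [Matrix.mul_assoc]

theorem IsLinkDecomposition.trFst_apply {X : Matrix ((Σ k, a k) × (Σ m, b m) × (Σ n, c n))
      ((Σ k, a k) × (Σ m, b m) × (Σ n, c n)) ℂ} (hX : X ∈ tripleAlg a b c) {d : ℕ}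
    {X₁ : ∀ (m : μ) (_ : ν), Matrix ((Σ k, a k) × b m × Fin d) ((Σ k, a k) × b m × Fin d) ℂ}
    {X₀ : ∀ n : ν, Matrix (Fin d × c n) (Fin d × c n) ℂ}
    (h : IsLinkDecomposition a b c X d X₁ X₀) (m : μ) (n : ν) (x x' : b m) (y y' : c n) :
    trFst X (⟨m, x⟩, ⟨n, y⟩) (⟨m, x'⟩, ⟨n, y'⟩) =
      (1 : Matrix (b m) (b m) ℂ) x x' * trFst (X₀ n) y y' := by
  have h1 := trFst_link₃ (trFst_eq_one_of_mem_channelChois (h.channel m n)) (X₀ n)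
  rw [← (centralProj_mul_eq_cornerIncl_iff a b c hX m n _).mp (h.link m n)] at h1
  exact congrFun (congrFun h1 (x, y)) (x', y')

theorem trFst_apply_eq_zero {X : Matrix ((Σ k, a k) × (Σ m, b m) × (Σ n, c n))
      ((Σ k, a k) × (Σ m, b m) × (Σ n, c n)) ℂ} (hX : X ∈ tripleAlg a b c)
    {p q : (Σ m, b m) × (Σ n, c n)} (h : p.1.1 ≠ q.1.1 ∨ p.2.1 ≠ q.2.1) : trFst X p q = 0 :=
  Finset.sum_eq_zero fun _ _ => tripleAlg_apply_eq_zero a b c hX (Or.inr h)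

theorem IsLinkDecomposition.exists_trFst_eq {X : Matrix ((Σ k, a k) × (Σ m, b m) × (Σ n, c n))
      ((Σ k, a k) × (Σ m, b m) × (Σ n, c n)) ℂ} (hX : X ∈ tripleAlg a b c) {d : ℕ}
    {X₁ : ∀ (m : μ) (_ : ν), Matrix ((Σ k, a k) × b m × Fin d) ((Σ k, a k) × b m × Fin d) ℂ}
    {X₀ : ∀ n : ν, Matrix (Fin d × c n) (Fin d × c n) ℂ}
    (h : IsLinkDecomposition a b c X d X₁ X₀) :
    ∃ Y ∈ directSumAlg c, Y.PosSemidef ∧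
      trFst X = (1 : Matrix (Σ m, b m) (Σ m, b m) ℂ) ⊗ₖ Y := by
  let Y : Matrix (Σ n, c n) (Σ n, c n) ℂ :=
    ∑ n, blockIncl c n * trFst (X₀ n) * (blockIncl c n).conjTranspose
  have hY0 : ∀ i j : (Σ n, c n), i.1 ≠ j.1 → Y i j = 0 := by
    intro i j hij
    simp only [Y, Matrix.sum_apply]
    refine Finset.sum_eq_zero fun n _ => blockIncl_conj_apply_of_ne c _ ?_
    by_contra! hn
    exact hij (hn.1.trans hn.2.symm)
  have hYn : ∀ n (y y' : c n), Y ⟨n, y⟩ ⟨n, y'⟩ = trFst (X₀ n) y y' := by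
    intro n y y'
    simp only [Y, Matrix.sum_apply]
    rw [Finset.sum_eq_single n]
    · exact blockIncl_conj_apply c n _ y y'
    · exact fun k _ hk => blockIncl_conj_apply_of_ne c _ (Or.inl hk.symm)
    · simp
  refine ⟨Y, hY0, Matrix.posSemidef_sum _ fun n _ =>
    (posSemidef_trFst (h.pos n)).mul_mul_conjTranspose_same _, ?_⟩
  ext ⟨⟨m, x⟩, ⟨n, y⟩⟩ ⟨⟨m', x'⟩, ⟨n', y'⟩⟩
  rw [Matrix.kroneckerMap_apply]
  by_cases hm : m = m'
  · by_cases hn : n = n'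
    · subst hm hn
      rw [h.trFst_apply a b c hX, hYn]
      simp [Matrix.one_apply]
    · rw [trFst_apply_eq_zero a b c hX (Or.inr hn), hY0 _ _ hn, mul_zero]
  · rw [trFst_apply_eq_zero a b c hX (Or.inl hm), Matrix.one_apply_ne, zero_mul]
    exact fun h => hm (congrArg Sigma.fst h)

theorem IsLinkDecomposition.blockIncl_trFst_eq [Nonempty μ] [∀ m, Nonempty (b m)]
    {X : Matrix ((Σ k, a k) × (Σ m, b m) × (Σ n, c n))
      ((Σ k, a k) × (Σ m, b m) × (Σ n, c n)) ℂ} (hX : X ∈ tripleAlg a b c)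
    {Y : Matrix (Σ n, c n) (Σ n, c n) ℂ} (hY : Y ∈ directSumAlg c)
    (hXY : trFst X = (1 : Matrix (Σ m, b m) (Σ m, b m) ℂ) ⊗ₖ Y) {d : ℕ}
    {X₁ : ∀ (m : μ) (_ : ν), Matrix ((Σ k, a k) × b m × Fin d) ((Σ k, a k) × b m × Fin d) ℂ}
    {X₀ : ∀ n : ν, Matrix (Fin d × c n) (Fin d × c n) ℂ}
    (h : IsLinkDecomposition a b c X d X₁ X₀) (n : ν) :
    blockIncl c n * trFst (X₀ n) * (blockIncl c n).conjTranspose = centralProj c n * Y := by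
  -- One diagonal entry in the `ℬ` factor suffices to read off `Y`; it exists because `ℬ` is
  -- nonzero.
  obtain ⟨m⟩ := ‹Nonempty μ›
  obtain ⟨x⟩ := ‹∀ m, Nonempty (b m)› m
  ext ⟨i, y⟩ ⟨j, z⟩
  rw [centralProj, Matrix.diagonal_mul]
  by_cases hi : i = n
  · subst hi
    by_cases hj : j = i
    · subst hj
      have h1 := h.trFst_apply a b c hX m j x x y z
      rw [hXY, Matrix.kroneckerMap_apply, Matrix.one_apply_eq, Matrix.one_apply_eq, one_mul,
        one_mul] at h1
      rw [blockIncl_conj_apply, h1]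
      simp
    · rw [blockIncl_conj_apply_of_ne c _ (Or.inr hj), hY _ _ (Ne.symm hj), mul_zero]
  · rw [blockIncl_conj_apply_of_ne c _ (Or.inl hi)]
    simp [hi]

theorem exists_isLinkDecomposition [Nonempty κ] [∀ k, Nonempty (a k)] [Nonempty ν]
    [∀ n, Nonempty (c n)]
    {X : Matrix ((Σ k, a k) × (Σ m, b m) × (Σ n, c n))
      ((Σ k, a k) × (Σ m, b m) × (Σ n, c n)) ℂ} (hX : X ∈ tripleAlg a b c) (hpos : X.PosSemidef)
    {Y : Matrix (Σ n, c n) (Σ n, c n) ℂ} (hY : Y.PosSemidef)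
    (hXY : trFst X = (1 : Matrix (Σ m, b m) (Σ m, b m) ℂ) ⊗ₖ Y) :
    ∃ d : ℕ, 0 < d ∧ ∃ X₁ X₀, IsLinkDecomposition a b c X d X₁ X₀ := by
  have : Nonempty (Σ k, a k) := Nonempty.map (fun k => ⟨k, Classical.arbitrary _⟩) ‹Nonempty κ›
  have : Nonempty (Σ n, c n) := Nonempty.map (fun n => ⟨n, Classical.arbitrary _⟩) ‹Nonempty ν›
  -- Taking `d = dim ℋ_C` gives one ancilla large enough for every block of `𝒞`.
  let f : ∀ n, c n ↪ Fin (Fintype.card (Σ n, c n)) := fun n =>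
    (Function.Embedding.sigmaMk n).trans (Fintype.equivFin (Σ n, c n)).toEmbedding
  choose Z hZ hC using fun n => exists_link₃_eq (f n) (hY.submatrix (Sigma.mk n))
  have key : ∀ m n, trFst (X.submatrix (cornerMap (Σ k, a k) b c m n)
      (cornerMap (Σ k, a k) b c m n)) =
      (1 : Matrix (b m) (b m) ℂ) ⊗ₖ Y.submatrix (Sigma.mk n) (Sigma.mk n) := by
    intro m n
    ext ⟨x, y⟩ ⟨x', y'⟩
    refine (congrFun (congrFun hXY (⟨m, x⟩, ⟨n, y⟩)) (⟨m, x'⟩, ⟨n, y'⟩)).trans ?_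
    simp [Matrix.one_apply]
  choose C hCpos hCtr hClink hCblock using fun m n =>
    hC n (hpos.submatrix (cornerMap (Σ k, a k) b c m n)) (key m n)
  refine ⟨_, Fintype.card_pos, C, Z, hZ, fun m n => ?_, fun m n => ?_⟩
  · refine mem_channelChois (hCpos m n) (hCtr m n) fun p q i j hij => ?_
    refine congrFun (congrFun (hCblock m n i j (fun h => hij (congrArg Sigma.fst h)) ?_) p) q
    ext s t
    exact tripleAlg_apply_eq_zero a b c hX (Or.inl hij)
  · exact (centralProj_mul_eq_cornerIncl_iff a b c hX m n _).mpr (hClink m n).symm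

end Corners

end QLink

theorem mainTheorem12 {κ μ ν : Type*} (a : κ → Type*) (b : μ → Type*) (c : ν → Type*)
    [Fintype κ] [Fintype μ] [Fintype ν] [DecidableEq κ] [DecidableEq μ] [DecidableEq ν]
    [∀ k, Fintype (a k)] [∀ m, Fintype (b m)] [∀ n, Fintype (c n)]
    [∀ k, DecidableEq (a k)] [∀ m, DecidableEq (b m)] [∀ n, DecidableEq (c n)]
    [Nonempty κ] [Nonempty μ] [Nonempty ν]
    [∀ k, Nonempty (a k)] [∀ m, Nonempty (b m)] [∀ n, Nonempty (c n)]
    (X : Matrix ((Σ k, a k) × (Σ m, b m) × (Σ n, c n))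
      ((Σ k, a k) × (Σ m, b m) × (Σ n, c n)) ℂ)
    (hX : X ∈ QLink.tripleAlg a b c) (hpos : X.PosSemidef) :
    ((∃ Y ∈ QLink.directSumAlg c, Y.PosSemidef ∧
        QLink.trFst X = (1 : Matrix (Σ m, b m) (Σ m, b m) ℂ) ⊗ₖ Y) ↔
      ∃ d : ℕ, 0 < d ∧ ∃ X₁ X₀, QLink.IsLinkDecomposition a b c X d X₁ X₀) ∧
    (∀ Y ∈ QLink.directSumAlg c, Y.PosSemidef →
      QLink.trFst X = (1 : Matrix (Σ m, b m) (Σ m, b m) ℂ) ⊗ₖ Y →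
      ∀ (d : ℕ) (X₁ : ∀ (m : μ) (_ : ν),
          Matrix ((Σ k, a k) × b m × Fin d) ((Σ k, a k) × b m × Fin d) ℂ)
        (X₀ : ∀ n : ν, Matrix (Fin d × c n) (Fin d × c n) ℂ),
        QLink.IsLinkDecomposition a b c X d X₁ X₀ →
        ∀ n, QLink.blockIncl c n * QLink.trFst (X₀ n) * (QLink.blockIncl c n).conjTranspose =
          QLink.centralProj c n * Y) := by
  exact ⟨⟨fun ⟨_, _, hY, hXY⟩ => QLink.exists_isLinkDecomposition a b c hX hpos hY hXY,
      fun ⟨_, _, _, _, h⟩ => h.exists_trFst_eq a b c hX⟩,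
    fun _ hY _ hXY _ _ _ h n => h.blockIncl_trFst_eq a b c hX hY hXY n⟩
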